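/- Let $\Omega=(0,1)\times(0,1)$ with points $(x,t)$, let $\kappa\ge 0$, $\alpha,\bar u_1,\bar u_2\in\mathbb R$, and let $u_0:(0,1)\to\mathbb R$ be a prescribed initial datum (for instance $u_0\in L^2(0,1)$; uniqueness needs no regularity of $u_0$, an integral below whose integrand is not integrable being read as $0$). Let $H^1(\Omega)$ be the Sobolev space of functions in $L^2(\Omega)$ with weak first derivatives in $L^2(\Omega)$, boundary values being understood as traces, and put $$S_\lambda=\{\lambda\in H^1(\Omega):\ \lambda(0,t)=\lambda(1,t)=\lambda(x,1)=0\},\qquad S_\mu=H^1(\Omega).$$ Consider the dual variational system of the transient convection--diffusion problem $\kappa u_{xx}-\alpha u_x=u_t$ in $\Omega$, $u(0,t)=\bar u_1$, $u(1,t)=\bar u_2$, $u(x,0)=u_0(x)$: find $(\lambda,\mu)\in S_\lambda\times S_\mu$ such that $$a_{11}(\lambda,\delta\lambda)+a_{12}(\mu,\delta\lambda)=\ell_1(\delta\lambda)\quad\forall\,\delta\lambda\in S_\lambda,\qquad a_{21}(\lambda,\delta\mu)+a_{22}(\mu,\delta\mu)=\ell_2(\delta\mu)\quad\forall\,\delta\mu\in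 S_\mu,$$ where $$a_{11}(\lambda,\delta\lambda)=\int_\Omega\big[\partial_t\lambda\,\partial_t\delta\lambda+(\alpha\lambda+\kappa\,\partial_x\lambda)(\alpha\,\delta\lambda+\kappa\,\partial_x\delta\lambda)\big]\,dx\,dt,$$ $$a_{12}(\mu,\delta\lambda)=\int_\Omega\big[\partial_x\mu\,\partial_t\delta\lambda-\mu(\alpha\,\delta\lambda+\kappa\,\partial_x\delta\lambda)\big]\,dx\,dt,$$ $$a_{21}(\lambda,\delta\mu)=\int_\Omega\big[\partial_t\lambda\,\partial_x\delta\mu-(\alpha\lambda+\kappa\,\partial_x\lambda)\,\delta\mu\big]\,dx\,dt,\qquad a_{22}(\mu,\delta\mu)=\int_\Omega\big[\partial_x\mu\,\partial_x\delta\mu+\mu\,\delta\mu\big]\,dx\,dt,$$ $$\ell_1(\delta\lambda)=-\int_0^1u_0(x)\,\delta\lambda(x,0)\,dx,\qquad \ell_2(\delta\mu)=\int_0^1\big[\bar u_2\,\delta\mu(1,t)-\bar u_1\,\delta\mu(0,t)\big]\,dt.$$ This system has at most one solution: if $(\lambda_1,\mu_1)$ and $(\lambda_2,\mu_2)$ are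 two solutions, then $\lambda_1=\lambda_2$ and $\mu_1=\mu_2$ a.e. in $\Omega$. -/

import Mathlib

open Set Filter Topology MeasureTheory
open scoped ContDiff

noncomputable section

namespace DualCD

/-- The space-time domain `Ω = (0,1) × (0,1)`; points are written `(x, t)`. -/
def Ω : Set (ℝ × ℝ) := Ioo (0 : ℝ) 1 ×ˢ Ioo (0 : ℝ) 1

/-- Lebesgue measure on `Ω`. -/
def volΩ : Measure (ℝ × ℝ) := volume.restrict Ω

/-- Lebesgue measure on `(0,1)`, the parameter interval of each side of the square. -/
def volI : Measure ℝ := volume.restrict (Ioo (0 : ℝ) 1)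

/-- The unit vector in the direction `x`. -/
def ex : ℝ × ℝ := (1, 0)

/-- The unit vector in the direction `t`. -/
def et : ℝ × ℝ := (0, 1)

/-- `g ∈ L²(Ω)` is the weak derivative of `f` on `Ω` in the direction `v`:
`∫ f ∂_v φ = - ∫ g φ` for every test function `φ ∈ C_c^∞(Ω)`. -/
def IsWeakDeriv (v : ℝ × ℝ) (f g : ℝ × ℝ → ℝ) : Prop :=
  MemLp g 2 volΩ ∧
  ∀ φ : ℝ × ℝ → ℝ, ContDiff ℝ ∞ φ → HasCompactSupport φ → tsupport φ ⊆ Ω →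
    ∫ z, f z * fderiv ℝ φ z v ∂volΩ = - ∫ z, g z * φ z ∂volΩ

/-- Membership in the Sobolev space `H¹(Ω)`: the function and its weak first derivatives are
square integrable. Elements of `H¹(Ω)` are such functions up to equality a.e. in `Ω`. -/
def MemH1 (f : ℝ × ℝ → ℝ) : Prop :=
  MemLp f 2 volΩ ∧ (∃ g, IsWeakDeriv ex f g) ∧ (∃ g, IsWeakDeriv et f g)

open Classical in
/-- The weak derivative of `f` in the direction `v` (unique up to equality a.e. in `Ω`; it is
only used where it exists). -/
def weakDeriv (v : ℝ × ℝ) (f : ℝ × ℝ → ℝ) : ℝ × ℝ → ℝ :=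
  if h : ∃ g, IsWeakDeriv v f g then h.choose else 0

/-- The weak derivative `∂f/∂x`. -/
def dx (f : ℝ × ℝ → ℝ) : ℝ × ℝ → ℝ := weakDeriv ex f

/-- The weak derivative `∂f/∂t`. -/
def dt (f : ℝ × ℝ → ℝ) : ℝ × ℝ → ℝ := weakDeriv et f

/-- The side `x = 0`, parametrized by `t`. -/
def left (t : ℝ) : ℝ × ℝ := (0, t)

/-- The side `x = 1`, parametrized by `t`. -/
def right (t : ℝ) : ℝ × ℝ := (1, t)

/-- The side `t = 0`, parametrized by `x`. -/
def bottom (x : ℝ) : ℝ × ℝ := (x, 0)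

/-- The side `t = 1`, parametrized by `x`. -/
def top (x : ℝ) : ℝ × ℝ := (x, 1)

/-- `g ∈ L²(0,1)` is the trace of `f ∈ H¹(Ω)` on the side `γ`: some sequence of functions that
are smooth up to the boundary converges to `f` in `H¹(Ω)`, and its restrictions to the side
converge to `g` in `L²(0,1)`. -/
def IsTrace (γ : ℝ → ℝ × ℝ) (f : ℝ × ℝ → ℝ) (g : ℝ → ℝ) : Prop :=
  MemLp g 2 volI ∧
  ∃ φ : ℕ → ℝ × ℝ → ℝ,
    (∀ n, ContDiff ℝ ∞ (φ n)) ∧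
    Tendsto (fun n => eLpNorm (fun z => φ n z - f z) 2 volΩ) atTop (𝓝 0) ∧
    Tendsto (fun n => eLpNorm (fun z => fderiv ℝ (φ n) z ex - dx f z) 2 volΩ) atTop (𝓝 0) ∧
    Tendsto (fun n => eLpNorm (fun z => fderiv ℝ (φ n) z et - dt f z) 2 volΩ) atTop (𝓝 0) ∧
    Tendsto (fun n => eLpNorm (fun s => φ n (γ s) - g s) 2 volI) atTop (𝓝 0)

open Classical in
/-- The trace of `f` on the side `γ`. On each of the four sides every `f ∈ H¹(Ω)` has exactly
one trace (up to equality a.e.), so no other value is ever used. -/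
def trace (γ : ℝ → ℝ × ℝ) (f : ℝ × ℝ → ℝ) : ℝ → ℝ :=
  if h : ∃ g, IsTrace γ f g then h.choose else 0

/-- `S_λ = {λ ∈ H¹(Ω) : λ(0,t) = λ(1,t) = λ(x,1) = 0}`, in the sense of traces. -/
def Sl : Set (ℝ × ℝ → ℝ) :=
  {f | MemH1 f ∧ IsTrace left f 0 ∧ IsTrace right f 0 ∧ IsTrace top f 0}

/-- `S_μ = H¹(Ω)`. -/
def Sm : Set (ℝ × ℝ → ℝ) := {f | MemH1 f}

/-- `a₁₁(λ, δλ)`. -/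
def a11 (κ α : ℝ) (l δl : ℝ × ℝ → ℝ) : ℝ :=
  ∫ z, (dt l z * dt δl z + (α * l z + κ * dx l z) * (α * δl z + κ * dx δl z)) ∂volΩ

/-- `a₁₂(μ, δλ)`. -/
def a12 (κ α : ℝ) (m δl : ℝ × ℝ → ℝ) : ℝ :=
  ∫ z, (dx m z * dt δl z - m z * (α * δl z + κ * dx δl z)) ∂volΩ

/-- `a₂₁(λ, δμ)`. -/
def a21 (κ α : ℝ) (l δm : ℝ × ℝ → ℝ) : ℝ :=
  ∫ z, (dt l z * dx δm z - (α * l z + κ * dx l z) * δm z) ∂volΩ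

/-- `a₂₂(μ, δμ)`. -/
def a22 (m δm : ℝ × ℝ → ℝ) : ℝ :=
  ∫ z, (dx m z * dx δm z + m z * δm z) ∂volΩ

/-- `ℓ₁(δλ) = - ∫₀¹ u₀(x) δλ(x,0) dx`. -/
def ell1 (u₀ : ℝ → ℝ) (δl : ℝ × ℝ → ℝ) : ℝ :=
  - ∫ x, u₀ x * trace bottom δl x ∂volI

/-- `ℓ₂(δμ) = ∫₀¹ [ū₂ δμ(1,t) - ū₁ δμ(0,t)] dt`. -/
def ell2 (ub₁ ub₂ : ℝ) (δm : ℝ × ℝ → ℝ) : ℝ :=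
  ∫ t, (ub₂ * trace right δm t - ub₁ * trace left δm t) ∂volI

/-- `(l, m)` (that is, `(λ, μ)`) solves the dual variational system with diffusion coefficient
`κ`, convection coefficient `α`, initial datum `u₀` and boundary data `ub₁`, `ub₂`. -/
structure IsDualSolution (κ α : ℝ) (u₀ : ℝ → ℝ) (ub₁ ub₂ : ℝ) (l m : ℝ × ℝ → ℝ) : Prop where
  mem_l : l ∈ Sl
  mem_m : m ∈ Sm
  eq_l : ∀ δl ∈ Sl, a11 κ α l δl + a12 κ α m δl = ell1 u₀ δl
  eq_m : ∀ δm ∈ Sm, a21 κ α l δm + a22 m δm = ell2 ub₁ ub₂ δm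

end DualCD

end

namespace DualCD

/-! The difference (λ, μ) of two solutions solves the homogeneous system. Testing that system with
(λ, μ) itself gives ∫ (λ_t + μ_x)² + (αλ + κλ_x - μ)² = 0 (`quadratic_form_eq`), hence μ_x = -λ_t
and μ = αλ + κλ_x a.e. (`strong_form`).

Now multiply μ_x = -λ_t by tλ and integrate by parts. The lateral traces of λ vanish, so ∫ t(μ_x λ +
μ λ_x) = 0 and ∫ t λ λ_x = 0. The trace at t = 1 vanishes and the weight t vanishes at t = 0, where
λ is free, so 2 ∫ t λ λ_t = -∫ λ². Together these give κ ∫ t λ_x² + ½ ∫ λ² = 0. The second term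
forces λ = 0 even when κ = 0, and then μ = 0.

The analytic work lies in the integrations by parts, `integral_weight_mul_dx` and
`integral_weight_mul_dt`. The weight t is replaced by compactly supported cutoffs of it, for which
the weak product rule has no boundary terms. The cutoff derivatives have size N on strips of width
2/N; a Poincaré inequality bounds λ there by 2/N times the norm of its derivative, so those terms
vanish in the limit (`tendsto_integral_strip`). -/

/-! ### Square integrability on the unit square. -/

instance : IsFiniteMeasure volΩ := by
  unfold volΩ Ω
  refine ⟨?_⟩
  rw [Measure.restrict_apply_univ, Measure.volume_eq_prod, Measure.prod_prod]
  simp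

instance : IsProbabilityMeasure volI := by
  unfold volI
  refine ⟨?_⟩
  simp

lemma isOpen_Ω : IsOpen Ω := isOpen_Ioo.prod isOpen_Ioo

lemma volΩ_eq_prod : volΩ = volI.prod volI := by
  unfold volΩ volI Ω
  rw [Measure.prod_restrict, Measure.volume_eq_prod]

lemma ae_mem_Ω : ∀ᵐ z ∂volΩ, z ∈ Ω := ae_restrict_mem isOpen_Ω.measurableSet

/-- Multiplication by a bounded weight preserves `L²(Ω)`. -/
lemma memLp_mul_bounded {f w : ℝ × ℝ → ℝ} (hf : MemLp f 2 volΩ) (hw : Measurable w) {C : ℝ}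
    (hC : ∀ z ∈ Ω, |w z| ≤ C) : MemLp (fun z => w z * f z) 2 volΩ := by
  refine MemLp.of_le_mul (c := C) hf (hw.aestronglyMeasurable.mul hf.1) ?_
  filter_upwards [ae_mem_Ω] with z hz
  rw [norm_mul]
  exact mul_le_mul_of_nonneg_right (hC z hz) (norm_nonneg _)

lemma exists_bound_Ω {w : ℝ × ℝ → ℝ} (hw : Continuous w) : ∃ C, ∀ z ∈ Ω, |w z| ≤ C := by
  have hK : IsCompact (Icc (0 : ℝ) 1 ×ˢ Icc (0 : ℝ) 1) := isCompact_Icc.prod isCompact_Icc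
  obtain ⟨C, hC⟩ := hK.exists_bound_of_continuousOn hw.continuousOn
  exact ⟨C, fun z hz => hC z ⟨Ioo_subset_Icc_self hz.1, Ioo_subset_Icc_self hz.2⟩⟩

lemma memLp_of_continuous {w : ℝ × ℝ → ℝ} (hw : Continuous w) : MemLp w 2 volΩ := by
  obtain ⟨C, hC⟩ := exists_bound_Ω hw
  refine MemLp.of_bound hw.aestronglyMeasurable C ?_
  filter_upwards [ae_mem_Ω] with z hz using hC z hz

lemma continuous_fderiv_dir {φ : ℝ × ℝ → ℝ} (hφ : ContDiff ℝ ∞ φ) (v : ℝ × ℝ) :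
    Continuous fun z => fderiv ℝ φ z v :=
  (hφ.continuous_fderiv (by simp)).clm_apply continuous_const

lemma integrable_mul_of_memLp {f g : ℝ × ℝ → ℝ} (hf : MemLp f 2 volΩ) (hg : MemLp g 2 volΩ) :
    Integrable (fun z => f z * g z) volΩ :=
  hf.integrable_mul hg

/-! ### Weak derivatives: differences and uniqueness. -/

lemma IsWeakDeriv.sub {v : ℝ × ℝ} {f₁ f₂ g₁ g₂ : ℝ × ℝ → ℝ} (hf₁ : MemLp f₁ 2 volΩ)
    (hf₂ : MemLp f₂ 2 volΩ) (h₁ : IsWeakDeriv v f₁ g₁) (h₂ : IsWeakDeriv v f₂ g₂) :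
    IsWeakDeriv v (f₁ - f₂) (g₁ - g₂) := by
  refine ⟨h₁.1.sub h₂.1, fun φ hφ hc hs => ?_⟩
  have m1 := memLp_of_continuous (continuous_fderiv_dir hφ v)
  have m2 := memLp_of_continuous hφ.continuous
  simp only [Pi.sub_apply, sub_mul]
  rw [integral_sub (integrable_mul_of_memLp hf₁ m1) (integrable_mul_of_memLp hf₂ m1),
    integral_sub (integrable_mul_of_memLp h₁.1 m2) (integrable_mul_of_memLp h₂.1 m2), h₁.2 φ hφ hc hs,
    h₂.2 φ hφ hc hs]
  ring

/-- Fundamental lemma of the calculus of variations, applied to `g₁ - g₂`. Since `dx` and `dt` are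
arbitrary choices of representatives, every identity between them, such as additivity, passes
through this lemma and holds only a.e. -/
lemma IsWeakDeriv.ae_eq {v : ℝ × ℝ} {f₁ f₂ g₁ g₂ : ℝ × ℝ → ℝ} (hf : f₁ =ᵐ[volΩ] f₂)
    (h₁ : IsWeakDeriv v f₁ g₁) (h₂ : IsWeakDeriv v f₂ g₂) : g₁ =ᵐ[volΩ] g₂ := by
  have hd : MemLp (g₁ - g₂) 2 volΩ := h₁.1.sub h₂.1
  have hli : LocallyIntegrableOn (g₁ - g₂) Ω volume := by
    have : IntegrableOn (g₁ - g₂) Ω volume := hd.integrable (by norm_num)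
    exact this.locallyIntegrableOn
  have key := isOpen_Ω.ae_eq_zero_of_integral_contDiff_smul_eq_zero (μ := volume) hli ?_
  · have : ∀ᵐ z ∂volΩ, (g₁ - g₂) z = 0 := (ae_restrict_iff' isOpen_Ω.measurableSet).2 key
    filter_upwards [this] with z hz
    simpa [sub_eq_zero] using hz
  · intro φ hφ hc hs
    have m2 := memLp_of_continuous hφ.continuous
    have e : ∫ z, (g₁ z - g₂ z) * φ z ∂volΩ = 0 := by
      simp only [sub_mul]
      rw [integral_sub (integrable_mul_of_memLp h₁.1 m2) (integrable_mul_of_memLp h₂.1 m2)]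
      have e1 := h₁.2 φ hφ hc hs
      have e2 := h₂.2 φ hφ hc hs
      have e3 : ∫ z, f₁ z * fderiv ℝ φ z v ∂volΩ = ∫ z, f₂ z * fderiv ℝ φ z v ∂volΩ :=
        integral_congr_ae (by filter_upwards [hf] with z hz; rw [hz])
      linarith
    have e4 : ∫ z in Ω, φ z • (g₁ - g₂) z = 0 := by
      rw [← e]
      exact integral_congr_ae (Eventually.of_forall fun z => by simp [mul_comm])
    rw [← e4]
    refine (setIntegral_eq_integral_of_forall_compl_eq_zero fun z hz => ?_).symm
    rw [image_eq_zero_of_notMem_tsupport (fun h => hz (hs h)), zero_smul]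

lemma weakDeriv_spec {v : ℝ × ℝ} {f : ℝ × ℝ → ℝ} (h : ∃ g, IsWeakDeriv v f g) :
    IsWeakDeriv v f (weakDeriv v f) := by
  unfold weakDeriv
  rw [dif_pos h]
  exact h.choose_spec

lemma MemH1.dx {f : ℝ × ℝ → ℝ} (h : MemH1 f) : IsWeakDeriv ex f (dx f) := weakDeriv_spec h.2.1

lemma MemH1.dt {f : ℝ × ℝ → ℝ} (h : MemH1 f) : IsWeakDeriv et f (dt f) := weakDeriv_spec h.2.2

lemma MemH1.sub {f g : ℝ × ℝ → ℝ} (hf : MemH1 f) (hg : MemH1 g) : MemH1 (f - g) :=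
  ⟨hf.1.sub hg.1, ⟨_, hf.dx.sub hf.1 hg.1 hg.dx⟩, ⟨_, hf.dt.sub hf.1 hg.1 hg.dt⟩⟩

lemma MemH1.dx_sub {f g : ℝ × ℝ → ℝ} (hf : MemH1 f) (hg : MemH1 g) :
    DualCD.dx (f - g) =ᵐ[volΩ] DualCD.dx f - DualCD.dx g :=
  (hf.sub hg).dx.ae_eq EventuallyEq.rfl (hf.dx.sub hf.1 hg.1 hg.dx)

lemma MemH1.dt_sub {f g : ℝ × ℝ → ℝ} (hf : MemH1 f) (hg : MemH1 g) :
    DualCD.dt (f - g) =ᵐ[volΩ] DualCD.dt f - DualCD.dt g :=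
  (hf.sub hg).dt.ae_eq EventuallyEq.rfl (hf.dt.sub hf.1 hg.1 hg.dt)

/-! ### Differences of functions with zero trace. -/

lemma tendsto_eLpNorm_sub {X : Type*} [MeasurableSpace X] {μ : Measure X}
    {φ ψ D : ℕ → X → ℝ} {f g : X → ℝ}
    (mφ : ∀ n, AEStronglyMeasurable (fun z => φ n z - f z) μ)
    (mψ : ∀ n, AEStronglyMeasurable (fun z => ψ n z - g z) μ)
    (hφ : Tendsto (fun n => eLpNorm (fun z => φ n z - f z) 2 μ) atTop (𝓝 0))
    (hψ : Tendsto (fun n => eLpNorm (fun z => ψ n z - g z) 2 μ) atTop (𝓝 0))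
    (hD : ∀ n, D n =ᵐ[μ] fun z => (φ n z - f z) - (ψ n z - g z)) :
    Tendsto (fun n => eLpNorm (D n) 2 μ) atTop (𝓝 0) := by
  have h0 := hφ.add hψ
  rw [add_zero] at h0
  refine tendsto_of_tendsto_of_tendsto_of_le_of_le tendsto_const_nhds h0 (fun _ => zero_le) ?_
  intro n
  simp only
  rw [eLpNorm_congr_ae (hD n)]
  exact eLpNorm_sub_le (mφ n) (mψ n) (by norm_num)

lemma IsTrace.zero_sub {γ : ℝ → ℝ × ℝ} (hγ : Continuous γ) {f g : ℝ × ℝ → ℝ} (mf : MemH1 f)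
    (mg : MemH1 g) (hf : IsTrace γ f 0) (hg : IsTrace γ g 0) : IsTrace γ (f - g) 0 := by
  obtain ⟨h0, φ, hφ, a1, a2, a3, a4⟩ := hf
  obtain ⟨-, ψ, hψ, b1, b2, b3, b4⟩ := hg
  have hd : ∀ n z v, fderiv ℝ (φ n - ψ n) z v = fderiv ℝ (φ n) z v - fderiv ℝ (ψ n) z v := by
    intro n z v
    rw [fderiv_sub ((hφ n).differentiable (by simp) z) ((hψ n).differentiable (by simp) z)]
    rfl
  have mc : ∀ {w : ℝ × ℝ → ℝ}, Continuous w → AEStronglyMeasurable w volΩ :=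
    fun h => h.aestronglyMeasurable
  refine ⟨h0, fun n => φ n - ψ n, fun n => (hφ n).sub (hψ n), ?_, ?_, ?_, ?_⟩
  · refine tendsto_eLpNorm_sub (fun n => (mc (hφ n).continuous).sub mf.1.1)
      (fun n => (mc (hψ n).continuous).sub mg.1.1) a1 b1 fun n => Eventually.of_forall fun z => ?_
    simp only [Pi.sub_apply]; ring
  · refine tendsto_eLpNorm_sub (fun n => (mc (continuous_fderiv_dir (hφ n) ex)).sub mf.dx.1.1)
      (fun n => (mc (continuous_fderiv_dir (hψ n) ex)).sub mg.dx.1.1) a2 b2 fun n => ?_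
    filter_upwards [mf.dx_sub mg] with z hz
    rw [hz, hd]; simp only [Pi.sub_apply]; ring
  · refine tendsto_eLpNorm_sub (fun n => (mc (continuous_fderiv_dir (hφ n) et)).sub mf.dt.1.1)
      (fun n => (mc (continuous_fderiv_dir (hψ n) et)).sub mg.dt.1.1) a3 b3 fun n => ?_
    filter_upwards [mf.dt_sub mg] with z hz
    rw [hz, hd]; simp only [Pi.sub_apply]; ring
  · have mc' : ∀ {w : ℝ × ℝ → ℝ}, Continuous w →
        AEStronglyMeasurable (fun s => w (γ s) - (0 : ℝ → ℝ) s) volI :=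
      fun h => ((h.comp hγ).sub continuous_const).aestronglyMeasurable
    refine tendsto_eLpNorm_sub (fun n => mc' (hφ n).continuous)
      (fun n => mc' (hψ n).continuous) a4 b4 fun n => Eventually.of_forall fun z => ?_
    simp

lemma sub_mem_Sl {f g : ℝ × ℝ → ℝ} (hf : f ∈ Sl) (hg : g ∈ Sl) : f - g ∈ Sl := by
  obtain ⟨f0, f1, f2, f3⟩ := hf
  obtain ⟨g0, g1, g2, g3⟩ := hg
  refine ⟨f0.sub g0, f1.zero_sub ?_ f0 g0 g1, f2.zero_sub ?_ f0 g0 g2, f3.zero_sub ?_ f0 g0 g3⟩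
  · unfold left; fun_prop
  · unfold right; fun_prop
  · unfold top; fun_prop

/-! ### The weak product rule. -/

lemma eLpNorm_one_mul_le {X : Type*} [MeasurableSpace X] {μ : Measure X} {f g : X → ℝ}
    (hf : AEStronglyMeasurable f μ) (hg : AEStronglyMeasurable g μ) :
    eLpNorm (fun z => f z * g z) 1 μ ≤ eLpNorm f 2 μ * eLpNorm g 2 μ := by
  have h : eLpNorm (f • g) 1 μ ≤ eLpNorm f 2 μ * eLpNorm g 2 μ :=
    eLpNorm_smul_le_mul_eLpNorm (p := 2) (q := 2) (r := 1) hg hf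
  exact h

lemma tendsto_integral_mul {h g : ℝ × ℝ → ℝ} {φ : ℕ → ℝ × ℝ → ℝ} (hh : MemLp h 2 volΩ)
    (hg : MemLp g 2 volΩ) (hφ : ∀ n, MemLp (φ n) 2 volΩ)
    (hlim : Tendsto (fun n => eLpNorm (fun z => φ n z - g z) 2 volΩ) atTop (𝓝 0)) :
    Tendsto (fun n => ∫ z, h z * φ n z ∂volΩ) atTop (𝓝 (∫ z, h z * g z ∂volΩ)) := by
  refine tendsto_integral_of_L1' _ (integrable_mul_of_memLp hh hg).aestronglyMeasurable
    (Eventually.of_forall fun n => integrable_mul_of_memLp hh (hφ n)) ?_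
  have h0 := ENNReal.Tendsto.const_mul hlim (Or.inr hh.2.ne)
  rw [mul_zero] at h0
  refine tendsto_of_tendsto_of_tendsto_of_le_of_le tendsto_const_nhds h0 (fun _ => zero_le) ?_
  intro n
  have := eLpNorm_one_mul_le hh.1 ((hφ n).sub hg).1
  refine le_trans (le_of_eq (eLpNorm_congr_ae (Eventually.of_forall fun z => ?_))) this
  simp only [Pi.sub_apply]; ring

/-- The weak product rule tested against `w ∈ C_c^∞(Ω)`, one factor being a limit of smooth
functions. -/
lemma IsWeakDeriv.integral_fderiv_mul_mul {v : ℝ × ℝ} {f fv g gv w : ℝ × ℝ → ℝ}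
    {φ : ℕ → ℝ × ℝ → ℝ} (hf : MemLp f 2 volΩ) (hfv : IsWeakDeriv v f fv) (hg : MemLp g 2 volΩ)
    (hgv : MemLp gv 2 volΩ) (hφ : ∀ n, ContDiff ℝ ∞ (φ n))
    (lim : Tendsto (fun n => eLpNorm (fun z => φ n z - g z) 2 volΩ) atTop (𝓝 0))
    (limv : Tendsto (fun n => eLpNorm (fun z => fderiv ℝ (φ n) z v - gv z) 2 volΩ) atTop (𝓝 0))
    (hw : ContDiff ℝ ∞ w) (hc : HasCompactSupport w) (hs : tsupport w ⊆ Ω) :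
    ∫ z, fderiv ℝ w z v * (f z * g z) ∂volΩ =
      - ∫ z, w z * (fv z * g z + f z * gv z) ∂volΩ := by
  obtain ⟨C, hC⟩ := exists_bound_Ω hw.continuous
  obtain ⟨C', hC'⟩ := exists_bound_Ω (continuous_fderiv_dir hw v)
  have hwf := memLp_mul_bounded hf hw.continuous.measurable hC
  have hwf' := memLp_mul_bounded hf (continuous_fderiv_dir hw v).measurable hC'
  have hwfv := memLp_mul_bounded hfv.1 hw.continuous.measurable hC
  have mφ := fun n => memLp_of_continuous (hφ n).continuous
  have mφv := fun n => memLp_of_continuous (continuous_fderiv_dir (hφ n) v)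
  have t1 := tendsto_integral_mul hwf' hg mφ lim
  have t2 := tendsto_integral_mul hwfv hg mφ lim
  have t3 := tendsto_integral_mul hwf hgv mφv limv
  have key : ∀ n, ∫ z, fderiv ℝ w z v * f z * φ n z ∂volΩ =
      -(∫ z, w z * fv z * φ n z ∂volΩ + ∫ z, w z * f z * fderiv ℝ (φ n) z v ∂volΩ) := by
    intro n
    -- `w * φ n` is an admissible test function: `φ n` is smooth and `w` supplies the compact
    -- support in `Ω`.
    have h := hfv.2 (fun z => w z * φ n z) (hw.mul (hφ n)) hc.mul_right
      ((tsupport_mul_subset_left (f := w)).trans hs)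
    have e1 : ∀ z, f z * fderiv ℝ (fun z => w z * φ n z) z v =
        fderiv ℝ w z v * f z * φ n z + w z * f z * fderiv ℝ (φ n) z v := by
      intro z
      rw [fderiv_fun_mul (hw.differentiable (by simp) z) ((hφ n).differentiable (by simp) z)]
      simp only [_root_.add_apply, _root_.smul_apply, smul_eq_mul]
      ring
    simp only [e1] at h
    rw [integral_add (integrable_mul_of_memLp hwf' (mφ n))
      (integrable_mul_of_memLp hwf (mφv n))] at h
    have e2 : ∫ z, fv z * (w z * φ n z) ∂volΩ = ∫ z, w z * fv z * φ n z ∂volΩ :=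
      integral_congr_ae (Eventually.of_forall fun z => by ring)
    linarith
  have u := tendsto_nhds_unique t1 (((t2.add t3).neg).congr fun n => (key n).symm)
  rw [← integral_add (integrable_mul_of_memLp hwfv hg) (integrable_mul_of_memLp hwf hgv)] at u
  simp only [← mul_assoc, mul_add]
  exact u

/-! ### Poincaré inequalities on boundary strips. -/

/-- Fundamental theorem of calculus along a horizontal segment, then Cauchy–Schwarz; the factor `s`
is the length of the segment. -/
lemma enorm_sub_rpow_two_le {ψ : ℝ × ℝ → ℝ} (hψ : ContDiff ℝ ∞ ψ) {s τ : ℝ} (hs : s ∈ Ioo (0:ℝ) 1) :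
    ‖ψ (s, τ) - ψ (0, τ)‖ₑ ^ (2 : ℝ) ≤
      ENNReal.ofReal s * ∫⁻ r, ‖fderiv ℝ ψ (r, τ) ex‖ₑ ^ (2 : ℝ) ∂volI := by
  have hcont : Continuous fun r => fderiv ℝ ψ (r, τ) ex :=
    (continuous_fderiv_dir hψ ex).comp (by fun_prop)
  have hder : ∀ r, HasDerivAt (fun r => ψ (r, τ)) (fderiv ℝ ψ (r, τ) ex) r := by
    intro r
    have h1 : HasDerivAt (fun r : ℝ => (r, τ)) ((1 : ℝ), (0 : ℝ)) r :=
      (hasDerivAt_id r).prodMk (hasDerivAt_const r τ)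
    exact (hψ.differentiable (by simp) (r, τ)).hasFDerivAt.comp_hasDerivAt r h1
  have ftc := intervalIntegral.integral_eq_sub_of_hasDerivAt (a := 0) (b := s)
    (fun r _ => hder r) (hcont.intervalIntegrable _ _)
  set ρ := (volume : Measure ℝ).restrict (Ioc 0 s) with hρ
  have h1 : ‖ψ (s, τ) - ψ (0, τ)‖ₑ ≤ eLpNorm (fun r => fderiv ℝ ψ (r, τ) ex) 1 ρ := by
    rw [← ftc, intervalIntegral.integral_of_le hs.1.le, eLpNorm_one_eq_lintegral_enorm]
    exact enorm_integral_le_lintegral_enorm _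
  have h2 := eLpNorm_le_eLpNorm_mul_rpow_measure_univ (μ := ρ) (p := 1) (q := 2) (by norm_num)
    hcont.aestronglyMeasurable
  have hu : ρ univ = ENNReal.ofReal s := by simp [hρ]
  have h3 := ENNReal.rpow_le_rpow (h1.trans h2) (show (0:ℝ) ≤ 2 by norm_num)
  refine h3.trans ?_
  have h4 := eLpNorm_nnreal_pow_eq_lintegral (μ := ρ) (f := fun r => fderiv ℝ ψ (r, τ) ex)
    (p := 2) (by norm_num)
  simp only [ENNReal.coe_ofNat, NNReal.coe_ofNat] at h4
  rw [ENNReal.mul_rpow_of_nonneg _ _ (by norm_num), h4, hu, ← ENNReal.rpow_mul, mul_comm]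
  have hsub : Ioc 0 s ⊆ Ioo (0 : ℝ) 1 := fun r hr => ⟨hr.1, hr.2.trans_lt hs.2⟩
  norm_num
  gcongr
  exact Measure.restrict_mono hsub le_rfl

/-- Split `ψ` into its value on the side `x = 0` and the increment from it. In the squared norm of
the increment one factor `ε` comes from the pointwise bound and another from the width of the strip,
hence `ε` after taking the root. -/
lemma eLpNorm_strip_le_of_contDiff {ψ : ℝ × ℝ → ℝ} (hψ : ContDiff ℝ ∞ ψ) (ε : ℝ) :
    eLpNorm ψ 2 (volΩ.restrict {z | z.1 ≤ ε}) ≤ eLpNorm (fun τ => ψ (0, τ)) 2 volI +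
      ENNReal.ofReal ε * eLpNorm (fun z => fderiv ℝ ψ z ex) 2 volΩ := by
  have hset : MeasurableSet {z : ℝ × ℝ | z.1 ≤ ε} := measurableSet_le measurable_fst measurable_const
  set ν := volΩ.restrict {z | z.1 ≤ ε} with hν
  have hνp : ν = (volI.restrict (Iic ε)).prod volI := by
    have : {z : ℝ × ℝ | z.1 ≤ ε} = Iic ε ×ˢ univ := by ext z; simp
    rw [hν, volΩ_eq_prod, this, ← Measure.prod_restrict, Measure.restrict_univ]
  have c0 : Continuous fun z : ℝ × ℝ => ψ (0, z.2) := hψ.continuous.comp (by fun_prop)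
  have tri := eLpNorm_add_le (μ := ν) (p := 2) c0.aestronglyMeasurable
    (hψ.continuous.sub c0).aestronglyMeasurable (by norm_num)
  have e0 : (fun z : ℝ × ℝ => ψ (0, z.2)) + (ψ - fun z => ψ (0, z.2)) = ψ := by ext z; simp
  rw [e0] at tri
  refine tri.trans (add_le_add ?_ ?_)
  · have mp : MeasurePreserving Prod.snd volΩ volI := by
      rw [volΩ_eq_prod]; exact measurePreserving_snd
    have := eLpNorm_comp_measurePreserving (p := 2) (g := fun τ => ψ (0, τ))
      (hψ.continuous.comp (by fun_prop : Continuous fun τ : ℝ => ((0 : ℝ), τ))).aestronglyMeasurable mp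
    rw [← this]
    exact eLpNorm_mono_measure _ Measure.restrict_le_self
  · have hD := continuous_fderiv_dir hψ ex
    set D := fun z => fderiv ℝ ψ z ex with hDdef
    have p1 := eLpNorm_nnreal_pow_eq_lintegral (μ := ν) (f := fun z => ψ z - ψ (0, z.2))
      (p := 2) (by norm_num)
    have p2 := eLpNorm_nnreal_pow_eq_lintegral (μ := volΩ) (f := D) (p := 2) (by norm_num)
    simp only [ENNReal.coe_ofNat, NNReal.coe_ofNat] at p1 p2
    rw [← ENNReal.rpow_le_rpow_iff (show (0:ℝ) < 2 by norm_num),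
      ENNReal.mul_rpow_of_nonneg _ _ (by norm_num), p2]
    refine (le_of_eq p1).trans ?_
    have mD : Measurable fun z => ‖D z‖ₑ ^ (2:ℝ) := hD.measurable.enorm.pow_const _
    have hae : ∀ᵐ z ∂ν, ‖ψ z - ψ (0, z.2)‖ₑ ^ (2:ℝ) ≤
        ENNReal.ofReal ε * ∫⁻ r, ‖D (r, z.2)‖ₑ ^ (2:ℝ) ∂volI := by
      filter_upwards [ae_restrict_mem hset, ae_restrict_of_ae ae_mem_Ω] with z hz hzΩ
      refine (enorm_sub_rpow_two_le hψ (τ := z.2) hzΩ.1).trans ?_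
      gcongr
    have mH : Measurable fun τ => ∫⁻ r, ‖D (r, τ)‖ₑ ^ (2:ℝ) ∂volI := mD.lintegral_prod_left'
    have mH2 : Measurable fun z : ℝ × ℝ => ∫⁻ r, ‖D (r, z.2)‖ₑ ^ (2:ℝ) ∂volI :=
      mH.comp measurable_snd
    refine (lintegral_mono_ae hae).trans ?_
    rw [lintegral_const_mul _ mH2, hνp,
      lintegral_prod _ mH2.aemeasurable]
    simp only
    rw [lintegral_const,
      volΩ_eq_prod, lintegral_prod_symm _ mD.aemeasurable, Measure.restrict_apply_univ]
    have hle : volI (Iic ε) ≤ ENNReal.ofReal ε := by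
      unfold volI
      rw [Measure.restrict_apply measurableSet_Iic]
      refine (measure_mono (t := Ioc 0 ε) fun x hx => ⟨hx.2.1, hx.1⟩).trans ?_
      simp
    rw [show (2:ℝ) = 1 + 1 by norm_num, ENNReal.rpow_add_of_nonneg _ _ (by norm_num) (by norm_num),
      ENNReal.rpow_one, mul_assoc, mul_comm (∫⁻ _, _ ∂_)]
    gcongr

/-- Poincaré inequality on the strip `x ≤ ε` for a limit of smooth functions whose restrictions
to the side `x = 0` tend to zero. -/
lemma eLpNorm_strip_le {F G : ℝ × ℝ → ℝ} {ψ : ℕ → ℝ × ℝ → ℝ} (hF : MemLp F 2 volΩ)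
    (hG : MemLp G 2 volΩ) (hψ : ∀ n, ContDiff ℝ ∞ (ψ n))
    (lim : Tendsto (fun n => eLpNorm (fun z => ψ n z - F z) 2 volΩ) atTop (𝓝 0))
    (limx : Tendsto (fun n => eLpNorm (fun z => fderiv ℝ (ψ n) z ex - G z) 2 volΩ) atTop (𝓝 0))
    (lim0 : Tendsto (fun n => eLpNorm (fun τ => ψ n (0, τ)) 2 volI) atTop (𝓝 0)) (ε : ℝ) :
    eLpNorm F 2 (volΩ.restrict {z | z.1 ≤ ε}) ≤ ENNReal.ofReal ε * eLpNorm G 2 volΩ := by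
  have hb : ∀ n, eLpNorm F 2 (volΩ.restrict {z | z.1 ≤ ε}) ≤
      eLpNorm (fun z => ψ n z - F z) 2 volΩ + (eLpNorm (fun τ => ψ n (0, τ)) 2 volI +
        ENNReal.ofReal ε * (eLpNorm (fun z => fderiv ℝ (ψ n) z ex - G z) 2 volΩ +
          eLpNorm G 2 volΩ)) := by
    intro n
    have m1 := (memLp_of_continuous (hψ n).continuous).1
    have m2 := (memLp_of_continuous (continuous_fderiv_dir (hψ n) ex)).1
    have h1 := eLpNorm_sub_le (μ := volΩ.restrict {z | z.1 ≤ ε}) (p := 2)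
      m1.restrict (m1.sub hF.1).restrict (by norm_num)
    have h2 := eLpNorm_add_le (μ := volΩ) (p := 2) (m2.sub hG.1) hG.1 (by norm_num)
    have e1 : ψ n - (ψ n - F) = F := by ext z; simp
    rw [e1] at h1
    have e2 : (fun z => fderiv ℝ (ψ n) z ex) - G + G = fun z => fderiv ℝ (ψ n) z ex := by
      ext z; simp
    rw [e2] at h2
    rw [add_comm] at h1
    refine h1.trans (add_le_add (eLpNorm_mono_measure _ Measure.restrict_le_self) ?_)
    refine (eLpNorm_strip_le_of_contDiff (hψ n) ε).trans ?_
    gcongr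
    exact h2
  have hl := lim.add (lim0.add (ENNReal.Tendsto.const_mul (a := ENNReal.ofReal ε)
    (limx.add_const (eLpNorm G 2 volΩ)) (Or.inr ENNReal.ofReal_ne_top)))
  simp only [zero_add] at hl
  exact ge_of_tendsto' hl hb

/-- Poincaré inequality on the strip `p ≤ ε` along the side `s = 0` of a chart `Φ` of the square,
for a function with zero trace on that side. -/
lemma eLpNorm_chart_strip_le {Φ : ℝ × ℝ → ℝ × ℝ} (hΦ : ContDiff ℝ ∞ Φ)
    (mp : MeasurePreserving Φ volΩ volΩ) {p : ℝ × ℝ → ℝ} (mpm : Measurable p)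
    (hp : ∀ z, p (Φ z) = z.1) {v : ℝ × ℝ} {c : ℝ} (hc : |c| = 1)
    (hΦv : ∀ z, fderiv ℝ Φ z ex = c • v) {f fv : ℝ × ℝ → ℝ} {φ : ℕ → ℝ × ℝ → ℝ}
    (hf : MemLp f 2 volΩ) (hfv : MemLp fv 2 volΩ) (hφ : ∀ n, ContDiff ℝ ∞ (φ n))
    (lim : Tendsto (fun n => eLpNorm (fun z => φ n z - f z) 2 volΩ) atTop (𝓝 0))
    (limv : Tendsto (fun n => eLpNorm (fun z => fderiv ℝ (φ n) z v - fv z) 2 volΩ) atTop (𝓝 0))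
    (lim0 : Tendsto (fun n => eLpNorm (fun τ => φ n (Φ (0, τ))) 2 volI) atTop (𝓝 0)) (ε : ℝ) :
    eLpNorm f 2 (volΩ.restrict {z | p z ≤ ε}) ≤ ENNReal.ofReal ε * eLpNorm fv 2 volΩ := by
  have hset : MeasurableSet {z | p z ≤ ε} := measurableSet_le mpm measurable_const
  have hd : ∀ n z, fderiv ℝ (φ n ∘ Φ) z ex = c * fderiv ℝ (φ n) (Φ z) v := by
    intro n z
    rw [fderiv_comp z ((hφ n).differentiable (by simp) _) (hΦ.differentiable (by simp) _),
      ContinuousLinearMap.comp_apply, hΦv, map_smul, smul_eq_mul]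
  -- The chart may reverse the direction of differentiation; the sign `c` does not affect norms.
  have hcn : ∀ {g : ℝ × ℝ → ℝ}, AEStronglyMeasurable g volΩ →
      eLpNorm (fun z => c * g (Φ z)) 2 volΩ = eLpNorm g 2 volΩ := by
    intro g hg
    rw [← eLpNorm_comp_measurePreserving hg mp]
    refine eLpNorm_congr_norm_ae (Eventually.of_forall fun z => ?_)
    simp [norm_mul, hc]
  have key := eLpNorm_strip_le (F := f ∘ Φ) (G := fun z => c * fv (Φ z)) (ψ := fun n => φ n ∘ Φ)
    (hf.comp_measurePreserving mp) ((hfv.comp_measurePreserving mp).const_mul c)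
    (fun n => (hφ n).comp hΦ) ?_ ?_ lim0 ε
  · rw [hcn hfv.1] at key
    have mp' := mp.restrict_preimage hset
    have hpre : Φ ⁻¹' {z | p z ≤ ε} = {z | z.1 ≤ ε} := by
      ext z; simp [hp]
    rw [hpre] at mp'
    rwa [eLpNorm_comp_measurePreserving hf.1.restrict mp'] at key
  · refine lim.congr fun n => ?_
    exact (eLpNorm_comp_measurePreserving
      ((memLp_of_continuous (hφ n).continuous).1.sub hf.1) mp).symm
  · refine limv.congr fun n => ?_
    refine (hcn ((memLp_of_continuous (continuous_fderiv_dir (hφ n) v)).1.sub hfv.1)).symm.trans ?_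
    refine eLpNorm_congr_ae (Eventually.of_forall fun z => ?_)
    simp only [hd, Pi.sub_apply]
    ring

lemma measurePreserving_one_sub : MeasurePreserving (fun s : ℝ => 1 - s) volI volI := by
  have h := (Measure.measurePreserving_sub_left (volume : Measure ℝ) 1).restrict_preimage
    (measurableSet_Ioo (a := (0 : ℝ)) (b := 1))
  have e : (fun s : ℝ => 1 - s) ⁻¹' Ioo 0 1 = Ioo 0 1 := by
    ext s; simp only [mem_preimage, mem_Ioo]; constructor <;> rintro ⟨a, b⟩ <;> constructor <;> linarith
  rw [e] at h
  exact h

lemma measurePreserving_reflect :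
    MeasurePreserving (fun z : ℝ × ℝ => (1 - z.1, z.2)) volΩ volΩ := by
  rw [volΩ_eq_prod]
  exact measurePreserving_one_sub.prod (MeasurePreserving.id volI)

/-- This quarter turn sends `(0, s)` to `(s, 1)`, so the strip estimate at `t = 1` reduces to the
one at `x = 0`. -/
lemma measurePreserving_rotate :
    MeasurePreserving (fun z : ℝ × ℝ => (z.2, 1 - z.1)) volΩ volΩ := by
  have h := measurePreserving_reflect
  rw [volΩ_eq_prod] at h ⊢
  exact (Measure.measurePreserving_swap (μ := volI) (ν := volI)).comp h

lemma IsTrace.eLpNorm_left_strip_le {f : ℝ × ℝ → ℝ} (hf : MemH1 f) (h : IsTrace left f 0) (ε : ℝ) :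
    eLpNorm f 2 (volΩ.restrict {z | z.1 ≤ ε}) ≤ ENNReal.ofReal ε * eLpNorm (dx f) 2 volΩ := by
  obtain ⟨-, φ, hφ, a1, a2, -, a4⟩ := h
  refine eLpNorm_strip_le hf.1 hf.dx.1 hφ a1 a2 ?_ ε
  simpa [left] using a4

lemma IsTrace.eLpNorm_right_strip_le {f : ℝ × ℝ → ℝ} (hf : MemH1 f) (h : IsTrace right f 0)
    (ε : ℝ) :
    eLpNorm f 2 (volΩ.restrict {z | 1 - z.1 ≤ ε}) ≤ ENNReal.ofReal ε * eLpNorm (dx f) 2 volΩ := by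
  obtain ⟨-, φ, hφ, a1, a2, -, a4⟩ := h
  refine eLpNorm_chart_strip_le (Φ := fun z => (1 - z.1, z.2)) (by fun_prop)
    measurePreserving_reflect (by fun_prop) (by simp) (c := -1) (by simp) (fun z => ?_)
    hf.1 hf.dx.1 hφ a1 a2 ?_ ε
  · have : HasFDerivAt (fun z : ℝ × ℝ => (1 - z.1, z.2))
        ((0 - ContinuousLinearMap.fst ℝ ℝ ℝ).prod (ContinuousLinearMap.snd ℝ ℝ ℝ)) z :=
      ((hasFDerivAt_const (1 : ℝ) z).sub hasFDerivAt_fst).prodMk hasFDerivAt_snd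
    rw [this.fderiv]
    simp [ex]
  · simpa [right] using a4

lemma IsTrace.eLpNorm_top_strip_le {f : ℝ × ℝ → ℝ} (hf : MemH1 f) (h : IsTrace top f 0) (ε : ℝ) :
    eLpNorm f 2 (volΩ.restrict {z | 1 - z.2 ≤ ε}) ≤ ENNReal.ofReal ε * eLpNorm (dt f) 2 volΩ := by
  obtain ⟨-, φ, hφ, a1, -, a3, a4⟩ := h
  refine eLpNorm_chart_strip_le (Φ := fun z => (z.2, 1 - z.1)) (by fun_prop)
    measurePreserving_rotate (by fun_prop) (by simp) (c := -1) (by simp) (fun z => ?_)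
    hf.1 hf.dt.1 hφ a1 a3 ?_ ε
  · have : HasFDerivAt (fun z : ℝ × ℝ => (z.2, 1 - z.1))
        ((ContinuousLinearMap.snd ℝ ℝ ℝ).prod (0 - ContinuousLinearMap.fst ℝ ℝ ℝ)) z :=
      hasFDerivAt_snd.prodMk ((hasFDerivAt_const (1 : ℝ) z).sub hasFDerivAt_fst)
    rw [this.fderiv]
    simp [ex, et]
  · simpa [top] using a4

/-! ### Integrals over shrinking strips. -/

lemma tendsto_two_div_add_two : Tendsto (fun n : ℕ => 2 / ((n : ℝ) + 2)) atTop (𝓝 0) :=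
  tendsto_const_nhds.div_atTop
    (tendsto_atTop_add_const_right _ _ tendsto_natCast_atTop_atTop)

/-- The strips decrease to a set disjoint from `Ω`, so their measure tends to zero, and absolute
continuity of the integral of `f²` applies. -/
lemma tendsto_eLpNorm_strip {f p : ℝ × ℝ → ℝ} (hf : MemLp f 2 volΩ) (mp : Measurable p)
    (hp : ∀ z ∈ Ω, 0 < p z) :
    Tendsto (fun n : ℕ => eLpNorm f 2 (volΩ.restrict {z | p z ≤ 2 / ((n : ℝ) + 2)})) atTop
      (𝓝 0) := by
  have hm : Tendsto (fun n : ℕ => volΩ {z | p z ≤ 2 / ((n : ℝ) + 2)}) atTop (𝓝 0) := by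
    have h := tendsto_measure_iInter_atTop (μ := volΩ)
      (s := fun n : ℕ => {z | p z ≤ 2 / ((n : ℝ) + 2)})
      (fun n => (measurableSet_le mp measurable_const).nullMeasurableSet) ?_
      ⟨0, measure_ne_top _ _⟩
    · have h0 : volΩ (⋂ n : ℕ, {z | p z ≤ 2 / ((n : ℝ) + 2)}) = 0 := by
        refine measure_mono_null (t := Ωᶜ) (fun z hz hzΩ => ?_) (mem_ae_iff.1 ae_mem_Ω)
        have : p z ≤ 0 := ge_of_tendsto' tendsto_two_div_add_two fun n => mem_iInter.1 hz n
        exact absurd (hp z hzΩ) (not_lt.2 this)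
      rwa [h0] at h
    · intro a b hab z hz
      refine le_trans (show p z ≤ _ from hz) ?_
      have : (a : ℝ) ≤ b := by exact_mod_cast hab
      gcongr
  have hfin : ∫⁻ z, ‖f z‖ₑ ^ (2:ℝ) ∂volΩ ≠ ⊤ := by
    have p2 := eLpNorm_nnreal_pow_eq_lintegral (μ := volΩ) (f := f) (p := 2) (by norm_num)
    simp only [ENNReal.coe_ofNat, NNReal.coe_ofNat] at p2
    rw [← p2]
    exact ENNReal.rpow_ne_top_of_nonneg (by norm_num) hf.2.ne
  have h1 := tendsto_setLIntegral_zero hfin hm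
  have h2 := (ENNReal.continuous_rpow_const (y := 1 / 2)).tendsto 0 |>.comp h1
  rw [ENNReal.zero_rpow_of_pos (by norm_num)] at h2
  refine h2.congr fun n => ?_
  rw [eLpNorm_eq_lintegral_rpow_enorm_toReal (by norm_num) (by norm_num)]
  simp

/-- Weights of size `n` supported in a strip of width `2 / n` do not contribute in the limit when
one of the factors satisfies a Poincaré inequality on the strips. -/
lemma tendsto_integral_strip {f g p : ℝ × ℝ → ℝ} {K : ENNReal} {C : ℝ} {h : ℕ → ℝ × ℝ → ℝ}
    (hf : MemLp f 2 volΩ) (hg : MemLp g 2 volΩ) (mp : Measurable p) (hp : ∀ z ∈ Ω, 0 < p z)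
    (hK : K ≠ ⊤) (hC : 0 ≤ C)
    (hs : ∀ ε, eLpNorm g 2 (volΩ.restrict {z | p z ≤ ε}) ≤ ENNReal.ofReal ε * K)
    (hb : ∀ n : ℕ, ∀ z ∈ Ω, |h n z| ≤ C * (n + 2))
    (h0 : ∀ n : ℕ, ∀ z ∈ Ω, 2 / ((n : ℝ) + 2) < p z → h n z = 0) :
    Tendsto (fun n => ∫ z, h n z * (f z * g z) ∂volΩ) atTop (𝓝 0) := by
  have hlim := ENNReal.Tendsto.const_mul (a := ENNReal.ofReal (2 * C) * K)
    (tendsto_eLpNorm_strip hf mp hp) (Or.inr (ENNReal.mul_ne_top ENNReal.ofReal_ne_top hK))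
  rw [mul_zero] at hlim
  rw [tendsto_zero_iff_enorm_tendsto_zero]
  refine tendsto_of_tendsto_of_tendsto_of_le_of_le tendsto_const_nhds hlim (fun _ => zero_le) ?_
  intro n
  have hN : (0 : ℝ) < n + 2 := by positivity
  set A := {z | p z ≤ 2 / ((n : ℝ) + 2)} with hA
  have mA : MeasurableSet A := measurableSet_le mp measurable_const
  calc ‖∫ z, h n z * (f z * g z) ∂volΩ‖ₑ
      ≤ ∫⁻ z, ‖h n z * (f z * g z)‖ₑ ∂volΩ := enorm_integral_le_lintegral_enorm _
    _ ≤ ∫⁻ z, A.indicator (fun z => ENNReal.ofReal (C * (n + 2)) * ‖f z * g z‖ₑ) z ∂volΩ := by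
        refine lintegral_mono_ae ?_
        filter_upwards [ae_mem_Ω] with z hz
        by_cases hzA : z ∈ A
        · rw [indicator_of_mem hzA, enorm_mul]
          gcongr
          rw [Real.enorm_eq_ofReal_abs]
          exact ENNReal.ofReal_le_ofReal (hb n z hz)
        · rw [h0 n z hz (not_le.1 hzA)]
          simp
    _ = ENNReal.ofReal (C * (n + 2)) * eLpNorm (fun z => f z * g z) 1 (volΩ.restrict A) := by
        rw [lintegral_indicator mA, lintegral_const_mul' _ _ ENNReal.ofReal_ne_top,
          eLpNorm_one_eq_lintegral_enorm]
    _ ≤ ENNReal.ofReal (C * (n + 2)) *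
          (eLpNorm f 2 (volΩ.restrict A) * (ENNReal.ofReal (2 / ((n : ℝ) + 2)) * K)) := by
        gcongr
        exact (eLpNorm_one_mul_le hf.1.restrict hg.1.restrict).trans (by gcongr; exact hs _)
    -- The size of the weight cancels the width of the strip; the decay is left to the norm of `f`
    -- on the strip.
    _ = ENNReal.ofReal (2 * C) * K * eLpNorm f 2 (volΩ.restrict A) := by
        have : ENNReal.ofReal (2 * C) =
            ENNReal.ofReal (C * (n + 2)) * ENNReal.ofReal (2 / ((n : ℝ) + 2)) := by
          rw [← ENNReal.ofReal_mul (by positivity)]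
          congr 1
          field_simp
        rw [this]
        ring

/-! ### Smooth cutoffs and the approximations of the weight `t`. -/

lemma deriv_smoothTransition_of_one_lt {y : ℝ} (hy : 1 < y) :
    deriv Real.smoothTransition y = 0 := by
  have : Real.smoothTransition =ᶠ[𝓝 y] fun _ => 1 := by
    filter_upwards [lt_mem_nhds hy] with x hx using Real.smoothTransition.one_of_one_le hx.le
  rw [this.deriv_eq, deriv_const]

lemma deriv_smoothTransition_of_neg {y : ℝ} (hy : y < 0) :
    deriv Real.smoothTransition y = 0 := by
  have : Real.smoothTransition =ᶠ[𝓝 y] fun _ => 0 := by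
    filter_upwards [gt_mem_nhds hy] with x hx using Real.smoothTransition.zero_of_nonpos hx.le
  rw [this.deriv_eq, deriv_const]

lemma continuous_deriv_smoothTransition : Continuous (deriv Real.smoothTransition) :=
  (Real.smoothTransition.contDiff (n := 1)).continuous_deriv le_rfl

lemma exists_deriv_smoothTransition_bound :
    ∃ C, 0 ≤ C ∧ ∀ y, |deriv Real.smoothTransition y| ≤ C := by
  obtain ⟨C, hC⟩ := (isCompact_Icc (a := (0 : ℝ)) (b := 1)).exists_bound_of_continuousOn
    continuous_deriv_smoothTransition.continuousOn
  have hC0 : 0 ≤ C := (norm_nonneg _).trans (hC 0 ⟨le_rfl, zero_le_one⟩)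
  refine ⟨C, hC0, fun y => ?_⟩
  rcases lt_or_ge y 0 with h | h
  · rw [deriv_smoothTransition_of_neg h]; simpa
  rcases lt_or_ge 1 y with h' | h'
  · rw [deriv_smoothTransition_of_one_lt h']; simpa
  · exact hC y ⟨h, h'⟩

/-- A smooth cutoff on `(0,1)`, supported in `[1/N, 1 - 1/N]`. -/
noncomputable def cutoff (N x : ℝ) : ℝ :=
  Real.smoothTransition (N * x - 1) * Real.smoothTransition (N * (1 - x) - 1)

/-- The part of the derivative of `cutoff N` that is supported near `0`. -/
noncomputable def cutoffUp (N x : ℝ) : ℝ :=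
  N * deriv Real.smoothTransition (N * x - 1) * Real.smoothTransition (N * (1 - x) - 1)

/-- Minus the part of the derivative of `cutoff N` that is supported near `1`. -/
noncomputable def cutoffDown (N x : ℝ) : ℝ :=
  N * Real.smoothTransition (N * x - 1) * deriv Real.smoothTransition (N * (1 - x) - 1)

lemma smoothTransition_abs_le (y : ℝ) : |Real.smoothTransition y| ≤ 1 := by
  rw [abs_of_nonneg (Real.smoothTransition.nonneg y)]
  exact Real.smoothTransition.le_one y

lemma contDiff_cutoff (N : ℝ) : ContDiff ℝ ∞ (cutoff N) := by
  unfold cutoff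
  exact (Real.smoothTransition.contDiff.comp (by fun_prop)).mul
    (Real.smoothTransition.contDiff.comp (by fun_prop))

lemma hasDerivAt_cutoff (N x : ℝ) :
    HasDerivAt (cutoff N) (cutoffUp N x - cutoffDown N x) x := by
  have hS : ∀ y, HasDerivAt Real.smoothTransition (deriv Real.smoothTransition y) y := fun y =>
    ((Real.smoothTransition.contDiff (n := 1)).differentiable (by simp) y).hasDerivAt
  have h1 : HasDerivAt (fun x : ℝ => N * x - 1) N x := by
    simpa using ((hasDerivAt_id x).const_mul N).sub_const 1
  have h2 : HasDerivAt (fun x : ℝ => N * (1 - x) - 1) (-N) x := by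
    simpa using (((hasDerivAt_id x).const_sub 1).const_mul N).sub_const 1
  have := ((hS _).comp x h1).mul ((hS _).comp x h2)
  refine this.congr_deriv ?_
  unfold cutoffUp cutoffDown
  simp only [Function.comp_apply]
  ring

lemma cutoff_abs_le (N x : ℝ) : |cutoff N x| ≤ 1 := by
  unfold cutoff
  rw [abs_mul]
  exact mul_le_one₀ (smoothTransition_abs_le _) (abs_nonneg _) (smoothTransition_abs_le _)

lemma cutoffUp_abs_le {C : ℝ} (hC : ∀ y, |deriv Real.smoothTransition y| ≤ C) {N : ℝ}
    (hN : 0 ≤ N) (x : ℝ) : |cutoffUp N x| ≤ C * N := by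
  unfold cutoffUp
  rw [abs_mul, abs_mul, abs_of_nonneg hN, mul_comm C]
  calc N * |deriv Real.smoothTransition (N * x - 1)| * |Real.smoothTransition (N * (1 - x) - 1)|
      ≤ N * |deriv Real.smoothTransition (N * x - 1)| * 1 := by
        gcongr; exact smoothTransition_abs_le _
    _ ≤ N * C := by rw [mul_one]; gcongr; exact hC _

/-- By the symmetry of the cutoff under `x ↦ 1 - x`, bounds near `1` follow from those near `0`. -/
lemma cutoffDown_eq (N x : ℝ) : cutoffDown N x = cutoffUp N (1 - x) := by
  unfold cutoffDown cutoffUp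
  rw [sub_sub_cancel]
  ring

lemma cutoffUp_eq_zero {N x : ℝ} (hN : 0 < N) (hx : 2 / N < x) : cutoffUp N x = 0 := by
  unfold cutoffUp
  rw [deriv_smoothTransition_of_one_lt]
  · ring
  · rw [div_lt_iff₀ hN] at hx; linarith

lemma continuous_cutoffUp (N : ℝ) : Continuous (cutoffUp N) := by
  unfold cutoffUp
  exact (continuous_const.mul (continuous_deriv_smoothTransition.comp (by fun_prop))).mul
    (Real.smoothTransition.continuous.comp (by fun_prop))

lemma cutoff_eq_one {N x : ℝ} (hN : 0 < N) (hx : 2 / N ≤ x) (hx' : 2 / N ≤ 1 - x) :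
    cutoff N x = 1 := by
  rw [div_le_iff₀ hN] at hx hx'
  unfold cutoff
  rw [Real.smoothTransition.one_of_one_le (by linarith),
    Real.smoothTransition.one_of_one_le (by linarith), one_mul]

lemma cutoff_eq_zero {N x : ℝ} (hN : 0 < N) (hx : x ∉ Icc (1 / N) (1 - 1 / N)) :
    cutoff N x = 0 := by
  unfold cutoff
  rcases not_and_or.1 hx with h | h
  · rw [not_le, lt_div_iff₀ hN] at h
    rw [Real.smoothTransition.zero_of_nonpos (by linarith), zero_mul]
  · have h' : 1 - x < 1 / N := by linarith
    rw [lt_div_iff₀ hN] at h'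
    rw [Real.smoothTransition.zero_of_nonpos (x := N * (1 - x) - 1) (by linarith), mul_zero]

/-- Test functions on `Ω` converging to the weight `t`. -/
noncomputable def weight (n : ℕ) (z : ℝ × ℝ) : ℝ := cutoff (n + 2) z.1 * (z.2 * cutoff (n + 2) z.2)

lemma contDiff_weight (n : ℕ) : ContDiff ℝ ∞ (weight n) := by
  unfold weight
  exact ((contDiff_cutoff _).comp contDiff_fst).mul
    (contDiff_snd.mul ((contDiff_cutoff _).comp contDiff_snd))

lemma weight_eq_zero (n : ℕ) {z : ℝ × ℝ}
    (hz : z ∉ Icc (1 / ((n : ℝ) + 2)) (1 - 1 / ((n : ℝ) + 2)) ×ˢ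
      Icc (1 / ((n : ℝ) + 2)) (1 - 1 / ((n : ℝ) + 2))) : weight n z = 0 := by
  have hN : (0 : ℝ) < n + 2 := by positivity
  unfold weight
  rcases not_and_or.1 hz with h | h
  · rw [cutoff_eq_zero hN h, zero_mul]
  · rw [cutoff_eq_zero hN h, mul_zero, mul_zero]

lemma hasCompactSupport_weight (n : ℕ) : HasCompactSupport (weight n) :=
  HasCompactSupport.intro (isCompact_Icc.prod isCompact_Icc) fun _ hz => weight_eq_zero n hz

lemma tsupport_weight_subset (n : ℕ) : tsupport (weight n) ⊆ Ω := by
  have hN : (0 : ℝ) < 1 / (n + 2) := by positivity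
  have h1 : Icc (1 / ((n : ℝ) + 2)) (1 - 1 / ((n : ℝ) + 2)) ⊆ Ioo 0 1 := fun x hx =>
    ⟨hN.trans_le hx.1, by linarith [hx.2]⟩
  refine (closure_minimal (fun z hz => ?_) (isClosed_Icc.prod isClosed_Icc)).trans
    (prod_mono h1 h1)
  by_contra h
  exact hz (weight_eq_zero n h)

lemma weight_abs_le (n : ℕ) {z : ℝ × ℝ} (hz : z ∈ Ω) : |weight n z| ≤ 1 := by
  unfold weight
  rw [abs_mul, abs_mul]
  refine mul_le_one₀ (cutoff_abs_le _ _) (by positivity)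
    (mul_le_one₀ ?_ (abs_nonneg _) (cutoff_abs_le _ _))
  rw [abs_of_pos hz.2.1]
  exact hz.2.2.le

lemma fderiv_weight_ex (n : ℕ) (z : ℝ × ℝ) : fderiv ℝ (weight n) z ex =
    cutoffUp (n + 2) z.1 * (z.2 * cutoff (n + 2) z.2) -
      cutoffUp (n + 2) (1 - z.1) * (z.2 * cutoff (n + 2) z.2) := by
  have h1 : HasDerivAt (fun r : ℝ => (r, z.2)) ((1 : ℝ), (0 : ℝ)) z.1 :=
    (hasDerivAt_id z.1).prodMk (hasDerivAt_const z.1 z.2)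
  have h2 := ((contDiff_weight n).differentiable (by simp) z).hasFDerivAt.comp_hasDerivAt z.1 h1
  have h3 := (hasDerivAt_cutoff (n + 2) z.1).mul_const (z.2 * cutoff (n + 2) z.2)
  rw [← sub_mul, ← cutoffDown_eq]
  exact h2.unique h3

/-- The grouping separates the two ends: near `t = 0` the factor `z.2` keeps the first term bounded,
while the last term, near `t = 1`, needs the zero trace. -/
lemma fderiv_weight_et (n : ℕ) (z : ℝ × ℝ) : fderiv ℝ (weight n) z et =
    cutoff (n + 2) z.1 * (cutoff (n + 2) z.2 + z.2 * cutoffUp (n + 2) z.2) -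
      cutoff (n + 2) z.1 * z.2 * cutoffUp (n + 2) (1 - z.2) := by
  have h1 : HasDerivAt (fun r : ℝ => (z.1, r)) ((0 : ℝ), (1 : ℝ)) z.2 :=
    (hasDerivAt_const z.2 z.1).prodMk (hasDerivAt_id z.2)
  have h2 := ((contDiff_weight n).differentiable (by simp) z).hasFDerivAt.comp_hasDerivAt z.2 h1
  have h3 := ((hasDerivAt_id z.2).mul (hasDerivAt_cutoff (n + 2) z.2)).const_mul
    (cutoff (n + 2) z.1)
  have h4 := h2.unique h3
  refine h4.trans ?_
  rw [← cutoffDown_eq]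
  simp only [id]
  ring

/-! ### Passage to the limit and weighted integration by parts. -/

lemma eventually_two_div_lt {x : ℝ} (hx : 0 < x) : ∀ᶠ n : ℕ in atTop, 2 / ((n : ℝ) + 2) < x :=
  tendsto_two_div_add_two.eventually (gt_mem_nhds hx)

lemma eventually_cutoff_eq_one {x : ℝ} (hx : x ∈ Ioo (0 : ℝ) 1) :
    ∀ᶠ n : ℕ in atTop, cutoff (n + 2) x = 1 := by
  filter_upwards [eventually_two_div_lt hx.1, eventually_two_div_lt (sub_pos.2 hx.2)] with n h h'
  exact cutoff_eq_one (by positivity) h.le h'.le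

lemma tendsto_integral_bounded_weight {H : ℝ × ℝ → ℝ} (hH : Integrable H volΩ)
    {w : ℕ → ℝ × ℝ → ℝ} {u : ℝ × ℝ → ℝ} {C : ℝ} (hw : ∀ n, Continuous (w n))
    (hb : ∀ n, ∀ z ∈ Ω, |w n z| ≤ C) (hlim : ∀ z ∈ Ω, ∀ᶠ n in atTop, w n z = u z) :
    Tendsto (fun n => ∫ z, w n z * H z ∂volΩ) atTop (𝓝 (∫ z, u z * H z ∂volΩ)) := by
  refine tendsto_integral_of_dominated_convergence (fun z => C * ‖H z‖)
    (fun n => (hw n).aestronglyMeasurable.mul hH.1) (hH.norm.const_mul C) (fun n => ?_) ?_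
  · filter_upwards [ae_mem_Ω] with z hz
    rw [norm_mul]
    exact mul_le_mul_of_nonneg_right (hb n z hz) (norm_nonneg _)
  · filter_upwards [ae_mem_Ω] with z hz
    refine tendsto_const_nhds.congr' ?_
    filter_upwards [hlim z hz] with n hn
    rw [hn]

lemma tendsto_integral_weight {H : ℝ × ℝ → ℝ} (hH : Integrable H volΩ) :
    Tendsto (fun n => ∫ z, weight n z * H z ∂volΩ) atTop (𝓝 (∫ z, z.2 * H z ∂volΩ)) := by
  refine tendsto_integral_bounded_weight hH (C := 1) (fun n => (contDiff_weight n).continuous)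
    (fun n z hz => weight_abs_le n hz) fun z hz => ?_
  filter_upwards [eventually_cutoff_eq_one hz.1, eventually_cutoff_eq_one hz.2] with n h1 h2
  simp [weight, h1, h2]

lemma integrable_continuous_mul {w H : ℝ × ℝ → ℝ} (hw : Continuous w) (hH : Integrable H volΩ) :
    Integrable (fun z => w z * H z) volΩ := by
  obtain ⟨C, hC⟩ := exists_bound_Ω hw
  refine hH.bdd_mul (c := C) hw.aestronglyMeasurable ?_
  filter_upwards [ae_mem_Ω] with z hz using hC z hz

/-- Weighted integration by parts in `x`, without boundary terms when `l` vanishes on the lateral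
sides. -/
lemma integral_weight_mul_dx {l m : ℝ × ℝ → ℝ} (hl : MemH1 l) (h0 : IsTrace left l 0)
    (h1 : IsTrace right l 0) (hm : MemH1 m) :
    ∫ z, z.2 * (dx m z * l z + m z * dx l z) ∂volΩ = 0 := by
  obtain ⟨C, hC0, hC⟩ := exists_deriv_smoothTransition_bound
  have hK : eLpNorm (dx l) 2 volΩ ≠ ⊤ := hl.dx.1.2.ne
  have hN : ∀ n : ℕ, (0 : ℝ) < n + 2 := fun n => by positivity
  have hside : ∀ n : ℕ, ∀ z ∈ Ω, |z.2 * cutoff (n + 2) z.2| ≤ 1 := by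
    intro n z hz
    rw [abs_mul]
    refine mul_le_one₀ ?_ (abs_nonneg _) (cutoff_abs_le _ _)
    rw [abs_of_pos hz.2.1]
    exact hz.2.2.le
  have hb : ∀ (n : ℕ) (x : ℝ), ∀ z ∈ Ω,
      |cutoffUp (n + 2) x * (z.2 * cutoff (n + 2) z.2)| ≤ C * (n + 2) := by
    intro n x z hz
    rw [abs_mul]
    exact (mul_le_of_le_one_right (abs_nonneg _) (hside n z hz)).trans
      (cutoffUp_abs_le hC (hN n).le x)
  have cc : ∀ n : ℕ, Continuous fun z : ℝ × ℝ => z.2 * cutoff (n + 2) z.2 := fun n =>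
    continuous_snd.mul ((contDiff_cutoff _).continuous.comp continuous_snd)
  have tL := tendsto_integral_strip (p := fun z => z.1)
    (h := fun n z => cutoffUp (n + 2) z.1 * (z.2 * cutoff (n + 2) z.2)) hm.1 hl.1 measurable_fst
    (fun z hz => hz.1.1) hK hC0 (h0.eLpNorm_left_strip_le hl) (fun n z hz => hb n z.1 z hz)
    (fun n z _ hz => by rw [cutoffUp_eq_zero (hN n) hz, zero_mul])
  have tR := tendsto_integral_strip (p := fun z => 1 - z.1)
    (h := fun n z => cutoffUp (n + 2) (1 - z.1) * (z.2 * cutoff (n + 2) z.2)) hm.1 hl.1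
    (by fun_prop) (fun z hz => sub_pos.2 hz.1.2) hK hC0 (h1.eLpNorm_right_strip_le hl)
    (fun n z hz => hb n (1 - z.1) z hz)
    (fun n z _ hz => by rw [cutoffUp_eq_zero (hN n) hz, zero_mul])
  have hI := integrable_mul_of_memLp hm.1 hl.1
  have tW := tendsto_integral_weight
    ((integrable_mul_of_memLp hm.dx.1 hl.1).add (integrable_mul_of_memLp hm.1 hl.dx.1))
  -- The product rule needs some smooth approximation of `l`; the one witnessing the left trace
  -- serves, and its boundary values play no further role.
  obtain ⟨-, φ, hφ, a1, a2, -, -⟩ := h0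
  have key : ∀ n : ℕ, (∫ z, cutoffUp (n + 2) z.1 * (z.2 * cutoff (n + 2) z.2) * (m z * l z) ∂volΩ) -
      (∫ z, cutoffUp (n + 2) (1 - z.1) * (z.2 * cutoff (n + 2) z.2) * (m z * l z) ∂volΩ) =
      - ∫ z, weight n z * (dx m z * l z + m z * dx l z) ∂volΩ := by
    intro n
    rw [← hm.dx.integral_fderiv_mul_mul hm.1 hl.1 hl.dx.1 hφ a1 a2 (contDiff_weight n)
      (hasCompactSupport_weight n) (tsupport_weight_subset n), ← integral_sub]
    · refine integral_congr_ae (Eventually.of_forall fun z => ?_)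
      simp only [fderiv_weight_ex]
      ring
    · exact integrable_continuous_mul
        (((continuous_cutoffUp _).comp continuous_fst).mul (cc n)) hI
    · exact integrable_continuous_mul (((continuous_cutoffUp _).comp
        (continuous_const.sub continuous_fst)).mul (cc n)) hI
  have u := tendsto_nhds_unique (tL.sub tR) (tW.neg.congr fun n => (key n).symm)
  simp only [sub_zero] at u
  exact neg_eq_zero.1 u.symm

/-- Weighted integration by parts in `t` for a function vanishing on the side `t = 1`. -/
lemma integral_weight_mul_dt {l : ℝ × ℝ → ℝ} (hl : MemH1 l) (h1 : IsTrace top l 0) :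
    ∫ z, z.2 * (dt l z * l z + l z * dt l z) ∂volΩ = - ∫ z, l z * l z ∂volΩ := by
  obtain ⟨C, hC0, hC⟩ := exists_deriv_smoothTransition_bound
  have hK : eLpNorm (dt l) 2 volΩ ≠ ⊤ := hl.dt.1.2.ne
  have hN : ∀ n : ℕ, (0 : ℝ) < n + 2 := fun n => by positivity
  have cx : ∀ n : ℕ, Continuous fun z : ℝ × ℝ => cutoff (n + 2) z.1 := fun n =>
    (contDiff_cutoff _).continuous.comp continuous_fst
  have cB : ∀ n : ℕ, Continuous fun z : ℝ × ℝ =>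
      cutoff (n + 2) z.1 * (cutoff (n + 2) z.2 + z.2 * cutoffUp (n + 2) z.2) := fun n =>
    (cx n).mul (((contDiff_cutoff _).continuous.comp continuous_snd).add
      (continuous_snd.mul ((continuous_cutoffUp _).comp continuous_snd)))
  have cT : ∀ n : ℕ, Continuous fun z : ℝ × ℝ =>
      cutoff (n + 2) z.1 * z.2 * cutoffUp (n + 2) (1 - z.2) := fun n =>
    ((cx n).mul continuous_snd).mul
      ((continuous_cutoffUp _).comp (continuous_const.sub continuous_snd))
  have tT := tendsto_integral_strip (p := fun z => 1 - z.2)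
    (h := fun n z => cutoff (n + 2) z.1 * z.2 * cutoffUp (n + 2) (1 - z.2)) hl.1 hl.1
    (by fun_prop) (fun z hz => sub_pos.2 hz.2.2) hK hC0 (h1.eLpNorm_top_strip_le hl)
    (fun n z hz => by
      rw [abs_mul, abs_mul, abs_of_pos hz.2.1]
      exact (mul_le_of_le_one_left (abs_nonneg _) (mul_le_one₀ (cutoff_abs_le _ _) hz.2.1.le
        hz.2.2.le)).trans (cutoffUp_abs_le hC (hN n).le _))
    (fun n z _ hz => by rw [cutoffUp_eq_zero (hN n) hz, mul_zero])
  have hI := integrable_mul_of_memLp hl.1 hl.1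
  have tB : Tendsto (fun n : ℕ => ∫ z, cutoff (n + 2) z.1 *
      (cutoff (n + 2) z.2 + z.2 * cutoffUp (n + 2) z.2) * (l z * l z) ∂volΩ) atTop
      (𝓝 (∫ z, 1 * (l z * l z) ∂volΩ)) := by
    refine tendsto_integral_bounded_weight hI (C := 1 + C * 2) (u := fun _ => 1) cB ?_ ?_
    · intro n z hz
      rw [abs_mul]
      refine (mul_le_of_le_one_left (abs_nonneg _) (cutoff_abs_le _ _)).trans ?_
      refine (abs_add_le _ _).trans (add_le_add (cutoff_abs_le _ _) ?_)
      -- No boundary condition holds at `t = 0`. On the strip `t ≤ 2 / (n + 2)` the factor `t`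
      -- absorbs the growth `C * (n + 2)`, which gives the dominating constant `C * 2`.
      rcases lt_or_ge (2 / ((n : ℝ) + 2)) z.2 with h | h
      · rw [cutoffUp_eq_zero (hN n) h]
        simpa using hC0
      · rw [abs_mul, abs_of_pos hz.2.1]
        calc z.2 * |cutoffUp (n + 2) z.2| ≤ 2 / ((n : ℝ) + 2) * (C * (n + 2)) := by
              gcongr
              exact cutoffUp_abs_le hC (hN n).le _
          _ = C * 2 := by field_simp
    · intro z hz
      filter_upwards [eventually_cutoff_eq_one hz.1, eventually_cutoff_eq_one hz.2,
        eventually_two_div_lt hz.2.1] with n a b c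
      rw [a, b, cutoffUp_eq_zero (hN n) c]
      ring
  have tW := tendsto_integral_weight
    ((integrable_mul_of_memLp hl.dt.1 hl.1).add (integrable_mul_of_memLp hl.1 hl.dt.1))
  obtain ⟨-, φ, hφ, a1, -, a3, -⟩ := h1
  have key : ∀ n : ℕ, (∫ z, cutoff (n + 2) z.1 *
        (cutoff (n + 2) z.2 + z.2 * cutoffUp (n + 2) z.2) * (l z * l z) ∂volΩ) -
      (∫ z, cutoff (n + 2) z.1 * z.2 * cutoffUp (n + 2) (1 - z.2) * (l z * l z) ∂volΩ) =
      - ∫ z, weight n z * (dt l z * l z + l z * dt l z) ∂volΩ := by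
    intro n
    rw [← hl.dt.integral_fderiv_mul_mul hl.1 hl.1 hl.dt.1 hφ a1 a3 (contDiff_weight n)
      (hasCompactSupport_weight n) (tsupport_weight_subset n),
      ← integral_sub (integrable_continuous_mul (cB n) hI) (integrable_continuous_mul (cT n) hI)]
    refine integral_congr_ae (Eventually.of_forall fun z => ?_)
    simp only [fderiv_weight_et]
    ring
  have u := tendsto_nhds_unique (tB.sub tT) (tW.neg.congr fun n => (key n).symm)
  simp only [sub_zero, one_mul] at u
  rw [u, neg_neg]
  rfl

/-! ### The bilinear forms, the sum of squares and the energy identity. -/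

/-- The flux `α f + κ ∂f/∂x`. -/
noncomputable def flux (κ α : ℝ) (f : ℝ × ℝ → ℝ) (z : ℝ × ℝ) : ℝ := α * f z + κ * dx f z

lemma MemH1.memLp_flux {f : ℝ × ℝ → ℝ} (hf : MemH1 f) (κ α : ℝ) : MemLp (flux κ α f) 2 volΩ :=
  (hf.1.const_mul α).add (hf.dx.1.const_mul κ)

lemma MemH1.flux_sub {f g : ℝ × ℝ → ℝ} (hf : MemH1 f) (hg : MemH1 g) (κ α : ℝ) :
    flux κ α (f - g) =ᵐ[volΩ] flux κ α f - flux κ α g := by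
  filter_upwards [hf.dx_sub hg] with z hz
  simp only [flux, hz, Pi.sub_apply]
  ring

/-- The common shape of the four forms. Equality a.e. is all that `dx`, `dt` and `flux` of a
difference satisfy. -/
lemma integral_mul_add_mul_sub {p₁ p₂ p q₁ q₂ q r s : ℝ × ℝ → ℝ} (hp₁ : MemLp p₁ 2 volΩ)
    (hp₂ : MemLp p₂ 2 volΩ) (hp : p =ᵐ[volΩ] p₁ - p₂) (hq₁ : MemLp q₁ 2 volΩ)
    (hq₂ : MemLp q₂ 2 volΩ) (hq : q =ᵐ[volΩ] q₁ - q₂) (hr : MemLp r 2 volΩ)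
    (hs : MemLp s 2 volΩ) :
    ∫ z, (p z * r z + q z * s z) ∂volΩ =
      ∫ z, (p₁ z * r z + q₁ z * s z) ∂volΩ - ∫ z, (p₂ z * r z + q₂ z * s z) ∂volΩ := by
  refine Eq.trans (integral_congr_ae ?_)
    (integral_sub ((integrable_mul_of_memLp hp₁ hr).add (integrable_mul_of_memLp hq₁ hs))
      ((integrable_mul_of_memLp hp₂ hr).add (integrable_mul_of_memLp hq₂ hs)))
  filter_upwards [hp, hq] with z h1 h2
  simp only [h1, h2, Pi.sub_apply]
  ring

lemma a11_sub (κ α : ℝ) {l₁ l₂ δ : ℝ × ℝ → ℝ} (h₁ : MemH1 l₁) (h₂ : MemH1 l₂) (hδ : MemH1 δ) :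
    a11 κ α (l₁ - l₂) δ = a11 κ α l₁ δ - a11 κ α l₂ δ :=
  integral_mul_add_mul_sub h₁.dt.1 h₂.dt.1 (h₁.dt_sub h₂) (h₁.memLp_flux κ α)
    (h₂.memLp_flux κ α) (h₁.flux_sub h₂ κ α) hδ.dt.1 (hδ.memLp_flux κ α)

lemma a12_sub (κ α : ℝ) {m₁ m₂ δ : ℝ × ℝ → ℝ} (h₁ : MemH1 m₁) (h₂ : MemH1 m₂) (hδ : MemH1 δ) :
    a12 κ α (m₁ - m₂) δ = a12 κ α m₁ δ - a12 κ α m₂ δ := by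
  -- The minus sign of the form is moved into the second test factor.
  have := integral_mul_add_mul_sub h₁.dx.1 h₂.dx.1 (h₁.dx_sub h₂) h₁.1 h₂.1
    EventuallyEq.rfl hδ.dt.1 (hδ.memLp_flux κ α).neg
  simp only [Pi.neg_apply, mul_neg, ← sub_eq_add_neg] at this
  exact this

lemma a21_sub (κ α : ℝ) {l₁ l₂ δ : ℝ × ℝ → ℝ} (h₁ : MemH1 l₁) (h₂ : MemH1 l₂) (hδ : MemH1 δ) :
    a21 κ α (l₁ - l₂) δ = a21 κ α l₁ δ - a21 κ α l₂ δ := by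
  have := integral_mul_add_mul_sub h₁.dt.1 h₂.dt.1 (h₁.dt_sub h₂) (h₁.memLp_flux κ α)
    (h₂.memLp_flux κ α) (h₁.flux_sub h₂ κ α) hδ.dx.1 hδ.1.neg
  simp only [Pi.neg_apply, mul_neg, ← sub_eq_add_neg] at this
  exact this

lemma a22_sub {m₁ m₂ δ : ℝ × ℝ → ℝ} (h₁ : MemH1 m₁) (h₂ : MemH1 m₂) (hδ : MemH1 δ) :
    a22 (m₁ - m₂) δ = a22 m₁ δ - a22 m₂ δ :=
  integral_mul_add_mul_sub h₁.dx.1 h₂.dx.1 (h₁.dx_sub h₂) h₁.1 h₂.1 EventuallyEq.rfl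
    hδ.dx.1 hδ.1

/-- The quadratic form of the system is a sum of squares of the residuals of the strong form. -/
lemma quadratic_form_eq (κ α : ℝ) {l m : ℝ × ℝ → ℝ} (hl : MemH1 l) (hm : MemH1 m) :
    a11 κ α l l + a12 κ α m l + (a21 κ α l m + a22 m m) =
      ∫ z, ((dt l z + dx m z) ^ 2 + (flux κ α l z - m z) ^ 2) ∂volΩ := by
  have i {f g : ℝ × ℝ → ℝ} (hf : MemLp f 2 volΩ) (hg : MemLp g 2 volΩ) :=
    integrable_mul_of_memLp hf hg
  have hF := hl.memLp_flux κ α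
  have i11 := (i hl.dt.1 hl.dt.1).add (i hF hF)
  have i12 := (i hm.dx.1 hl.dt.1).sub (i hm.1 hF)
  have i21 := (i hl.dt.1 hm.dx.1).sub (i hF hm.1)
  have i22 := (i hm.dx.1 hm.dx.1).add (i hm.1 hm.1)
  have e1 := integral_add i11 i12
  have e2 := integral_add i21 i22
  have e3 := integral_add (i11.add i12) (i21.add i22)
  refine ((congrArg₂ (· + ·) e1 e2).symm.trans e3.symm).trans ?_
  refine integral_congr_ae (Eventually.of_forall fun z => ?_)
  simp only [Pi.add_apply, Pi.sub_apply]
  ring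

lemma strong_form {κ α : ℝ} {l m : ℝ × ℝ → ℝ} (hl : MemH1 l) (hm : MemH1 m)
    (h : a11 κ α l l + a12 κ α m l + (a21 κ α l m + a22 m m) = 0) :
    ∀ᵐ z ∂volΩ, dx m z = - dt l z ∧ m z = flux κ α l z := by
  rw [quadratic_form_eq κ α hl hm, integral_eq_zero_iff_of_nonneg (fun z => by positivity)] at h
  · filter_upwards [h] with z hz
    simp only [Pi.zero_apply] at hz
    have s1 := sq_nonneg (dt l z + dx m z)
    have s2 := sq_nonneg (flux κ α l z - m z)
    have h1 : (dt l z + dx m z) ^ 2 = 0 := by linarith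
    have h2 : (flux κ α l z - m z) ^ 2 = 0 := by linarith
    have h1' := pow_eq_zero_iff two_ne_zero |>.1 h1
    have h2' := pow_eq_zero_iff two_ne_zero |>.1 h2
    exact ⟨by linarith, by linarith⟩
  · exact ((hl.dt.1.add hm.dx.1).integrable_sq).add
      (((hl.memLp_flux κ α).sub hm.1).integrable_sq)

/-- The homogeneous system has only the trivial solution: the energy identity with weight `t`. -/
lemma ae_eq_zero_of_strong_form {κ α : ℝ} (hκ : 0 ≤ κ) {l m : ℝ × ℝ → ℝ} (hl : l ∈ Sl)
    (hm : MemH1 m) (h : ∀ᵐ z ∂volΩ, dx m z = - dt l z ∧ m z = flux κ α l z) :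
    (∀ᵐ z ∂volΩ, l z = 0) ∧ (∀ᵐ z ∂volΩ, m z = 0) := by
  obtain ⟨hl, hL, hR, hT⟩ := hl
  have i {f g : ℝ × ℝ → ℝ} (hf : MemLp f 2 volΩ) (hg : MemLp g 2 volΩ) :=
    integrable_mul_of_memLp hf hg
  have j {H : ℝ × ℝ → ℝ} (hH : Integrable H volΩ) := integrable_continuous_mul continuous_snd hH
  have E1 := integral_weight_mul_dx hl hL hR hm
  have E2 := integral_weight_mul_dx hl hL hR hl
  have E3 := integral_weight_mul_dt hl hT
  have J1 := j ((i hm.dx.1 hl.1).add (i hm.1 hl.dx.1))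
  have J2 := j ((i hl.dx.1 hl.1).add (i hl.1 hl.dx.1))
  have J3 := j ((i hl.dt.1 hl.1).add (i hl.1 hl.dt.1))
  have J4 := i hl.1 hl.1
  simp only [Pi.add_apply] at J1 J2 J3
  -- The combination `E1 - (α/2) E2 + (1/2) E3` is assembled, with `(1/2) ∫ l²` added: the second
  -- term cancels the convective part of `m * dx l`, the third cancels `dx m * l = -dt l * l`.
  have e1 := integral_add (J3.const_mul (1 / 2)) (J4.const_mul (1 / 2))
  have e2 := integral_sub J1 (J2.const_mul (α / 2))
  have e3 := integral_add (J1.sub (J2.const_mul (α / 2)))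
    ((J3.const_mul (1 / 2)).add (J4.const_mul (1 / 2)))
  simp only [Pi.add_apply, Pi.sub_apply] at e3
  rw [e1, e2] at e3
  simp only [integral_const_mul] at e3
  rw [E1, E2, E3] at e3
  have energy : ∫ z, (κ * (z.2 * dx l z ^ 2) + 1 / 2 * l z ^ 2) ∂volΩ = 0 := by
    refine Eq.trans (integral_congr_ae ?_) (e3.trans (by ring))
    filter_upwards [h] with z hz
    rw [hz.1, hz.2]
    simp only [flux]
    ring
  have hint : Integrable (fun z => κ * (z.2 * dx l z ^ 2) + 1 / 2 * l z ^ 2) volΩ :=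
    ((j hl.dx.1.integrable_sq).const_mul κ).add (hl.1.integrable_sq.const_mul _)
  have hnn : ∀ᵐ z ∂volΩ, 0 ≤ κ * (z.2 * dx l z ^ 2) := by
    filter_upwards [ae_mem_Ω] with z hz
    exact mul_nonneg hκ (mul_nonneg hz.2.1.le (sq_nonneg _))
  have hzero := (integral_eq_zero_iff_of_nonneg_ae (by
    filter_upwards [hnn] with z hz
    have := sq_nonneg (l z)
    simp only [Pi.zero_apply]
    linarith) hint).1 energy
  have l0 : l =ᵐ[volΩ] 0 := by
    filter_upwards [hzero, hnn] with z hz hz'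
    simp only [Pi.zero_apply] at hz ⊢
    have := sq_nonneg (l z)
    exact pow_eq_zero_iff two_ne_zero |>.1 (by linarith)
  -- Since `l = 0` a.e., uniqueness of weak derivatives gives `dx l = 0` a.e., so the flux, which
  -- equals `m`, vanishes.
  have w0 : IsWeakDeriv ex 0 0 := ⟨MemLp.zero, fun φ _ _ _ => by simp⟩
  refine ⟨l0, ?_⟩
  filter_upwards [h, l0, hl.dx.ae_eq l0 w0] with z hz a b
  rw [hz.2, flux, a, b]
  simp

end DualCD

theorem mainTheorem1 (κ α : ℝ) (hκ : 0 ≤ κ) (u₀ : ℝ → ℝ) (ub₁ ub₂ : ℝ)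
    (l₁ m₁ l₂ m₂ : ℝ × ℝ → ℝ)
    (h₁ : DualCD.IsDualSolution κ α u₀ ub₁ ub₂ l₁ m₁)
    (h₂ : DualCD.IsDualSolution κ α u₀ ub₁ ub₂ l₂ m₂) :
    (∀ᵐ z ∂DualCD.volΩ, l₁ z = l₂ z) ∧ (∀ᵐ z ∂DualCD.volΩ, m₁ z = m₂ z) := by
  have hl := DualCD.sub_mem_Sl h₁.mem_l h₂.mem_l
  have hm : DualCD.MemH1 (m₁ - m₂) := DualCD.MemH1.sub h₁.mem_m h₂.mem_m
  have hq : DualCD.a11 κ α (l₁ - l₂) (l₁ - l₂) + DualCD.a12 κ α (m₁ - m₂) (l₁ - l₂) +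
      (DualCD.a21 κ α (l₁ - l₂) (m₁ - m₂) + DualCD.a22 (m₁ - m₂) (m₁ - m₂)) = 0 := by
    rw [DualCD.a11_sub κ α h₁.mem_l.1 h₂.mem_l.1 hl.1, DualCD.a12_sub κ α h₁.mem_m h₂.mem_m hl.1,
      DualCD.a21_sub κ α h₁.mem_l.1 h₂.mem_l.1 hm, DualCD.a22_sub h₁.mem_m h₂.mem_m hm]
    -- For each test function both solutions have the same right-hand side, so it cancels as a
    -- number; neither linearity of the trace nor integrability of `u₀` enters.
    linarith [h₁.eq_l _ hl, h₂.eq_l _ hl, h₁.eq_m _ hm, h₂.eq_m _ hm]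
  obtain ⟨a, b⟩ := DualCD.ae_eq_zero_of_strong_form hκ hl hm (DualCD.strong_form hl.1 hm hq)
  constructor
  · filter_upwards [a] with z hz using sub_eq_zero.1 hz
  · filter_upwards [b] with z hz using sub_eq_zero.1 hz
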